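/- Let $R$ be a ring (associative, unital, not necessarily commutative); modules are left $R$-modules. Let $P_f(R)$ be the category of finitely generated projective modules, an exact category with the split exact sequences. For an exact category $\mathcal C$, let $\mathsf{Lex}(\mathcal C)$ be the category of presheaves of abelian groups on $\mathcal C$ that send each exact sequence $X\hookrightarrow Y\twoheadrightarrow Z$ to an exact sequence $0\to F(Z)\to F(Y)\to F(X)$. Let $\mathsf{Ind}^a(\mathcal C)\subset\mathsf{Lex}(\mathcal C)$ be the full subcategory of presheaves isomorphic to $\operatorname{colim}_{i\in I}\operatorname{Hom}_{\mathcal C}(-,X_i)$ for some functor $X\colon I\to\mathcal C$ from a directed poset taking every arrow to an admissible monic, and let $\mathsf{Ind}^a_\kappa(\mathcal C)$ be the full subcategory of those for which $I$ can be chosen with $|I|\le\kappa$. Let $\mathcal{FM}(\mathcal C)$ and $\mathcal{FM}_\kappa(\mathcal C)$ be the idempotent completions of $\mathsf{Ind}^a(\mathcal C)$ and $\mathsf{Ind}^a_\kappa(\mathcal C)$. A module $M$ is flat Mittag-Leffler if it is isomorphic to the colimit of a diagram $M_\bullet\colon I\to P_f(R)$ over a directed poset such that for every $i$ there is $j\ge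 i$ with $\operatorname{Im}(M_k^\vee\to M_i^\vee)=\operatorname{Im}(M_j^\vee\to M_i^\vee)$ for all $k\ge j$, where $(-)^\vee=\operatorname{Hom}_R(-,R)$. Let $\mathcal{FM}(R)$ be the full subcategory of flat Mittag-Leffler modules, and $\mathcal{FM}_\kappa(R)$ that of flat Mittag-Leffler modules generated by at most $\kappa$ elements. (1) If $M$ is a flat Mittag-Leffler module, then $M\oplus R^{(\omega)}$ is a flat Mittag-Leffler module which lies in the image of $\mathsf{Ind}^a(P_f(R))$, i.e. the presheaf $\operatorname{Hom}_R(-,M\oplus R^{(\omega)})$ on $P_f(R)$ is an object of $\mathsf{Ind}^a(P_f(R))$; and $M\oplus R^{(\omega)}$ is the union of a directed system of finitely generated projective submodules $P_i$ such that each inclusion $P_i\subseteq P_j$ ($i\le j$) splits. (2) There is an equivalence of categories $\mathcal{FM}(P_f(R))\simeq\mathcal{FM}(R)$, and for every infinite cardinal $\kappa$ there is an equivalence $\mathcal{FM}_\kappa(P_f(R))\simeq\mathcal{FM}_\kappa(R)$. These equivalences can be chosen compatibly with the functor $M\mapsto\operatorname{Hom}_R(-,M)$: the composites $\mathsf{Ind}^a(P_f(R))\to\mathcal{FM}(P_f(R))\simeq\mathcal{FM}(R)\to\mathsf{Lex}(P_f(R))$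 and $\mathsf{Ind}^a_\kappa(P_f(R))\to\mathcal{FM}_\kappa(P_f(R))\simeq\mathcal{FM}_\kappa(R)\to\mathsf{Lex}(P_f(R))$, whose last functor is $M\mapsto\operatorname{Hom}_R(-,M)$, are naturally isomorphic to the inclusions. -/

import Mathlib

universe w v u

namespace AdmissibleInd

open CategoryTheory CategoryTheory.Limits Opposite

/-! ### Exact categories -/

section Exact

variable {C : Type w} [Category.{v} C] [Preadditive C]

/-- `f` is the first map of a short complex in the class `E`. -/
def IsAdmissibleMono (E : ObjectProperty (ShortComplex C)) {X Y : C} (f : X ⟶ Y) : Prop :=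
  ∃ (Z : C) (g : Y ⟶ Z) (h : f ≫ g = 0), E (ShortComplex.mk f g h)

/-- `g` is the second map of a short complex in the class `E`. -/
def IsAdmissibleEpi (E : ObjectProperty (ShortComplex C)) {Y Z : C} (g : Y ⟶ Z) : Prop :=
  ∃ (X : C) (f : X ⟶ Y) (h : f ≫ g = 0), E (ShortComplex.mk f g h)

variable (C) in
/-- A (Quillen) exact structure on an additive category. -/
structure ExactStructure [HasFiniteBiproducts C] where
  /-- the class of exact sequences `X ↪ Y ↠ Z` -/
  exact : ObjectProperty (ShortComplex C)
  isoClosed : exact.IsClosedUnderIsomorphisms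
  isKernel : ∀ S : ShortComplex C, exact S → Nonempty (IsLimit (KernelFork.ofι S.f S.zero))
  isCokernel : ∀ S : ShortComplex C, exact S → Nonempty (IsColimit (CokernelCofork.ofπ S.g S.zero))
  mono_id : ∀ X : C, IsAdmissibleMono exact (𝟙 X)
  epi_id : ∀ X : C, IsAdmissibleEpi exact (𝟙 X)
  mono_comp : ∀ {X Y Z : C} (f : X ⟶ Y) (g : Y ⟶ Z),
    IsAdmissibleMono exact f → IsAdmissibleMono exact g → IsAdmissibleMono exact (f ≫ g)
  epi_comp : ∀ {X Y Z : C} (f : X ⟶ Y) (g : Y ⟶ Z),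
    IsAdmissibleEpi exact f → IsAdmissibleEpi exact g → IsAdmissibleEpi exact (f ≫ g)
  mono_pushout : ∀ {X Y W : C} (f : X ⟶ Y) (a : X ⟶ W), IsAdmissibleMono exact f →
    ∃ (P : C) (b : Y ⟶ P) (f' : W ⟶ P), IsPushout f a b f' ∧ IsAdmissibleMono exact f'
  epi_pullback : ∀ {Y Z W : C} (g : Y ⟶ Z) (a : W ⟶ Z), IsAdmissibleEpi exact g →
    ∃ (P : C) (b : P ⟶ Y) (g' : P ⟶ W), IsPullback b g' g a ∧ IsAdmissibleEpi exact g'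

variable (C) in
/-- Every additive category is exact with respect to the split exact sequences. -/
def splitExactStructure [HasFiniteBiproducts C] : ExactStructure C where
  exact S := Nonempty S.Splitting
  isoClosed := ⟨fun e ⟨s⟩ => ⟨s.ofIso e⟩⟩
  isKernel _ := fun ⟨s⟩ => ⟨s.fIsKernel⟩
  isCokernel _ := fun ⟨s⟩ => ⟨s.gIsCokernel⟩
  mono_id X := by
    have : HasZeroObject C := hasZeroObject_of_hasFiniteBiproducts C
    obtain ⟨ZZ, hZ⟩ := HasZeroObject.zero (C := C)
    exact ⟨ZZ, 0, by simp, ⟨⟨𝟙 X, 0, by simp, hZ.eq_of_src _ _, by simp⟩⟩⟩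
  epi_id X := by
    have : HasZeroObject C := hasZeroObject_of_hasFiniteBiproducts C
    obtain ⟨ZZ, hZ⟩ := HasZeroObject.zero (C := C)
    exact ⟨ZZ, 0, by simp, ⟨⟨0, 𝟙 X, hZ.eq_of_src _ _, by simp, by simp⟩⟩⟩
  mono_comp {X Y Z} f g := by
    rintro ⟨A, p, hp, ⟨r, s, h1, h2, h3⟩⟩ ⟨B, q, hq, ⟨r', s', k1, k2, k3⟩⟩
    have : HasBinaryBiproducts C := hasBinaryBiproducts_of_finite_biproducts C
    dsimp only at r s h1 h2 h3 r' s' k1 k2 k3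
    have e1 : s' ≫ r' = 0 := (ShortComplex.Splitting.mk (S := .mk g q hq) r' s' k1 k2 k3).s_r
    refine ⟨A ⊞ B, biprod.lift (r' ≫ p) q, ?_, ⟨⟨r' ≫ r, biprod.desc (s ≫ g) s', ?_, ?_, ?_⟩⟩⟩
    · ext <;> simp [hq, reassoc_of% k1, hp]
    · simp [reassoc_of% k1, h1]
    · ext <;> simp [h2, k2, reassoc_of% k1, reassoc_of% e1, hq]
    · have := congrArg (fun t => r' ≫ t ≫ g) h3
      simp only [Preadditive.add_comp, Preadditive.comp_add, Category.assoc,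
        Category.id_comp] at this
      simp only [biprod.lift_desc, Category.assoc]
      rw [← k3, ← this, add_assoc]
  epi_comp {X Y Z} f g := by
    rintro ⟨A, p, hp, ⟨r, s, h1, h2, h3⟩⟩ ⟨B, q, hq, ⟨r', s', k1, k2, k3⟩⟩
    have : HasBinaryBiproducts C := hasBinaryBiproducts_of_finite_biproducts C
    dsimp only at r s h1 h2 h3 r' s' k1 k2 k3
    have e1 : s ≫ r = 0 := (ShortComplex.Splitting.mk (S := .mk p f hp) r s h1 h2 h3).s_r
    refine ⟨A ⊞ B, biprod.desc p (q ≫ s), ?_, ⟨⟨biprod.lift r (f ≫ r'), s' ≫ s, ?_, ?_, ?_⟩⟩⟩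
    · ext <;> simp [hq, reassoc_of% h2, reassoc_of% hp]
    · ext <;> simp [h1, k1, e1, reassoc_of% h2, reassoc_of% hp]
    · simp [reassoc_of% h2, k2]
    · have := congrArg (fun t => f ≫ t ≫ s) k3
      simp only [Preadditive.add_comp, Preadditive.comp_add, Category.assoc,
        Category.id_comp] at this
      simp only [biprod.lift_desc, Category.assoc]
      rw [← h3, ← this, add_assoc]
  mono_pushout {X Y W} f a := by
    rintro ⟨A, p, hp, ⟨r, s, h1, h2, h3⟩⟩
    have : HasBinaryBiproducts C := hasBinaryBiproducts_of_finite_biproducts C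
    dsimp only at r s h1 h2 h3
    have e1 : s ≫ r = 0 := (ShortComplex.Splitting.mk (S := .mk f p hp) r s h1 h2 h3).s_r
    refine ⟨W ⊞ A, biprod.lift (r ≫ a) p, biprod.inl, ⟨⟨?_⟩, ⟨PushoutCocone.IsColimit.mk _
      (fun c => biprod.desc c.inr (s ≫ c.inl)) ?_ ?_ ?_⟩⟩,
      A, biprod.snd, by simp, ⟨⟨biprod.fst, biprod.inr, by simp, by simp, ?_⟩⟩⟩
    · ext <;> simp [reassoc_of% h1, hp]
    · intro c
      have := congrArg (fun t => t ≫ c.inl) h3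
      simp only [Preadditive.add_comp, Category.assoc, Category.id_comp] at this
      simp only [biprod.lift_desc, Category.assoc]
      rw [← c.condition]
      exact this
    · intro c; simp
    · intro c m hm1 hm2
      ext
      · simpa using hm2
      · have := congrArg (fun t => s ≫ t) hm1
        simp only [biprod.inr_desc] at this ⊢
        rw [← this, ← Category.assoc]
        congr 1
        ext <;> simp [reassoc_of% e1, h2]
    · exact biprod.total
  epi_pullback {Y Z W} g a := by
    rintro ⟨A, p, hp, ⟨r, s, h1, h2, h3⟩⟩
    have : HasBinaryBiproducts C := hasBinaryBiproducts_of_finite_biproducts C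
    dsimp only at r s h1 h2 h3
    have e1 : s ≫ r = 0 := (ShortComplex.Splitting.mk (S := .mk p g hp) r s h1 h2 h3).s_r
    refine ⟨A ⊞ W, biprod.desc p (a ≫ s), biprod.snd, ⟨⟨?_⟩, ⟨PullbackCone.IsLimit.mk _
      (fun c => biprod.lift (c.fst ≫ r) c.snd) ?_ ?_ ?_⟩⟩,
      A, biprod.inl, by simp, ⟨⟨biprod.fst, biprod.inr, by simp, by simp, ?_⟩⟩⟩
    · ext <;> simp [h2, hp]
    · intro c
      have := congrArg (fun t => c.fst ≫ t) h3
      simp only [Preadditive.comp_add, Category.comp_id] at this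
      simp only [biprod.lift_desc, Category.assoc]
      rw [← reassoc_of% c.condition]
      exact this
    · intro c; simp
    · intro c m hm1 hm2
      ext
      · have := congrArg (fun t => t ≫ r) hm1
        simp only [biprod.lift_fst] at this ⊢
        rw [← this, Category.assoc]
        congr 1
        ext <;> simp [e1, h1]
      · simpa using hm2
    · exact biprod.total

end Exact

/-! ### Left exact presheaves and admissible Ind-objects -/

section Ind

variable {C : Type w} [Category.{v} C] [Preadditive C] [HasFiniteBiproducts C]

/-- Left exact presheaves of abelian groups: for every exact sequence `X ↪ Y ↠ Z`, the sequence
`0 → F(Z) → F(Y) → F(X)` is exact. -/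
def isLeftExact (E : ExactStructure C) : ObjectProperty (Cᵒᵖ ⥤ AddCommGrpCat.{v}) := fun F =>
  ∀ S : ShortComplex C, E.exact S →
    Function.Injective (F.map S.g.op) ∧ Function.Exact (F.map S.g.op) (F.map S.f.op)

/-- The category of left exact presheaves. -/
abbrev Lex (E : ExactStructure C) := (isLeftExact E).FullSubcategory

/-- An admissible Ind-diagram: a functor from a (non-empty) directed poset taking every arrow to
an admissible monic. -/
structure AdmissibleIndDiagram (E : ExactStructure C) where
  I : Type v
  [partialOrder : PartialOrder I]
  [isDirected : IsDirected I (· ≤ ·)]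
  [nonempty : Nonempty I]
  X : I ⥤ C
  admissible : ∀ {i j : I} (f : i ⟶ j), IsAdmissibleMono E.exact (X.map f)

attribute [instance] AdmissibleIndDiagram.partialOrder AdmissibleIndDiagram.isDirected
  AdmissibleIndDiagram.nonempty

/-- The presheaf `Y ↦ colim_I Hom(Y, X_i)` (colimits of presheaves are computed pointwise). -/
noncomputable def AdmissibleIndDiagram.presheaf {E : ExactStructure C}
    (D : AdmissibleIndDiagram E) : Cᵒᵖ ⥤ AddCommGrpCat.{v} :=
  colimit (D.X ⋙ preadditiveYoneda)

/-- Admissible Ind-objects: left exact presheaves isomorphic to the presheaf of an admissible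
Ind-diagram. -/
def isAdmissibleInd (E : ExactStructure C) : ObjectProperty (Lex E) := fun F =>
  ∃ D : AdmissibleIndDiagram E, Nonempty (F.obj ≅ D.presheaf)

/-- Admissible Ind-objects of size at most `κ`. -/
def isAdmissibleIndOfSize (E : ExactStructure C) (κ : Cardinal.{v}) : ObjectProperty (Lex E) :=
  fun F => ∃ D : AdmissibleIndDiagram E, Cardinal.mk D.I ≤ κ ∧ Nonempty (F.obj ≅ D.presheaf)

/-- `Ind^a(C)` -/
abbrev IndA (E : ExactStructure C) := (isAdmissibleInd E).FullSubcategory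

/-- `Ind^a_κ(C)` -/
abbrev IndAOfSize (E : ExactStructure C) (κ : Cardinal.{v}) :=
  (isAdmissibleIndOfSize E κ).FullSubcategory

/-- `FM(C)`: the idempotent completion of `Ind^a(C)`. -/
abbrev FM (E : ExactStructure C) := Idempotents.Karoubi (IndA E)

/-- `FM_κ(C)`: the idempotent completion of `Ind^a_κ(C)`. -/
abbrev FMOfSize (E : ExactStructure C) (κ : Cardinal.{v}) :=
  Idempotents.Karoubi (IndAOfSize E κ)

end Ind

/-! ### Finitely generated projective modules -/

section Modules

variable (R : Type u) [Ring R]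

/-- Finitely generated projective left `R`-modules. -/
def isFGProjective : ObjectProperty (ModuleCat.{u} R) := fun M =>
  Module.Finite R M ∧ Module.Projective R M

/-- The category `P_f(R)`. -/
abbrev Pf := (isFGProjective R).FullSubcategory

instance (M : Pf R) : Module.Finite R M.obj := M.property.1

instance (M : Pf R) : Module.Projective R M.obj := M.property.2

instance : HasZeroObject (Pf R) where
  zero := ⟨⟨ModuleCat.of R PUnit.{u + 1}, inferInstanceAs (Module.Finite R PUnit.{u + 1}),
      inferInstanceAs (Module.Projective R PUnit.{u + 1})⟩, by
    rw [IsZero.iff_id_eq_zero]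
    ext x⟩

instance : HasBinaryBiproducts (Pf R) where
  has_binary_biproduct M N := by
    let P : Pf R := ⟨ModuleCat.of R (M.obj × N.obj), inferInstanceAs (Module.Finite R (_ × _)),
      inferInstanceAs (Module.Projective R (_ × _))⟩
    let b : BinaryBicone M N :=
      { pt := P
        fst := ObjectProperty.homMk (ModuleCat.ofHom (LinearMap.fst R M.obj N.obj))
        snd := ObjectProperty.homMk (ModuleCat.ofHom (LinearMap.snd R M.obj N.obj))
        inl := ObjectProperty.homMk (ModuleCat.ofHom (LinearMap.inl R M.obj N.obj))
        inr := ObjectProperty.homMk (ModuleCat.ofHom (LinearMap.inr R M.obj N.obj))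
        inl_fst := rfl
        inl_snd := rfl
        inr_fst := rfl
        inr_snd := rfl }
    refine ⟨⟨b, isBinaryBilimitOfTotal b ?_⟩⟩
    refine ObjectProperty.hom_ext _ (ModuleCat.hom_ext (LinearMap.ext fun x => ?_))
    have hx : ((x.1, 0) + (0, x.2) : M.obj × N.obj) = x := by
      rw [Prod.mk_add_mk, add_zero, zero_add]
    exact hx

instance : HasFiniteBiproducts (Pf R) :=
  have : HasFiniteProducts (Pf R) := hasFiniteProducts_of_has_binary_and_terminal
  HasFiniteBiproducts.of_hasFiniteProducts

/-- `P_f(R)` as an exact category, with the split exact sequences. -/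
noncomputable abbrev pfExact : ExactStructure (Pf R) := splitExactStructure (Pf R)

/-- The presheaf `Hom_R(-, M)` on `P_f(R)`, as a functor of the module `M`. -/
noncomputable def homPresheaf : ModuleCat.{u} R ⥤ (Pf R)ᵒᵖ ⥤ AddCommGrpCat.{u} :=
  preadditiveYoneda ⋙ (Functor.whiskeringLeft _ _ _).obj (isFGProjective R).ι.op

theorem isLeftExact_homPresheaf (M : ModuleCat.{u} R) :
    isLeftExact (pfExact R) ((homPresheaf R).obj M) := by
  rintro S ⟨σ⟩
  have e1 : σ.s.hom ≫ S.g.hom = 𝟙 _ := congrArg InducedCategory.Hom.hom σ.s_g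
  have e2 : σ.r.hom ≫ S.f.hom + S.g.hom ≫ σ.s.hom = 𝟙 _ :=
    congrArg InducedCategory.Hom.hom σ.id
  have e3 : S.f.hom ≫ S.g.hom = 0 := congrArg InducedCategory.Hom.hom S.zero
  have h1 (a b : S.X₃.obj ⟶ M) (h : S.g.hom ≫ a = S.g.hom ≫ b) : a = b := by
    have := congrArg (fun t => σ.s.hom ≫ t) h
    simpa only [reassoc_of% e1] using this
  have h2 (a : S.X₂.obj ⟶ M) (h : S.f.hom ≫ a = 0) : S.g.hom ≫ σ.s.hom ≫ a = a := by
    have := congrArg (fun t => t ≫ a) e2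
    simpa only [Preadditive.add_comp, Category.assoc, h, comp_zero, zero_add,
      Category.id_comp] using this
  have h3 (b : S.X₃.obj ⟶ M) : S.f.hom ≫ S.g.hom ≫ b = 0 := by
    rw [reassoc_of% e3, zero_comp]
  exact ⟨fun a b h => h1 a b h, fun a => ⟨fun h => ⟨_, h2 a h⟩, by rintro ⟨b, rfl⟩; exact h3 b⟩⟩

/-- The functor `Mod(R) ⥤ Lex(P_f(R))`, `M ↦ Hom_R(-, M)`. -/
noncomputable def modToLex : ModuleCat.{u} R ⥤ Lex (pfExact R) :=
  (isLeftExact (pfExact R)).lift (homPresheaf R) (isLeftExact_homPresheaf R)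

/-! ### Flat Mittag-Leffler modules -/

variable {R}

/-- The image of the restriction map `N^∨ → M^∨`, `φ ↦ φ ∘ f`, of the duals `Hom_R(-, R)`. -/
def dualImage {M N : ModuleCat.{u} R} (f : M ⟶ N) : Set (M →ₗ[R] R) :=
  Set.range fun φ : N →ₗ[R] R => φ ∘ₗ f.hom

variable (R)

/-- Flat Mittag-Leffler modules: colimits of directed diagrams `I → P_f(R)` such that for every
`i` there is `j ≥ i` with `Im(M_k^∨ → M_i^∨) = Im(M_j^∨ → M_i^∨)` for all `k ≥ j`. -/
def isFlatMittagLeffler : ObjectProperty (ModuleCat.{u} R) := fun M =>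
  ∃ (I : Type u) (_ : PartialOrder I) (_ : IsDirected I (· ≤ ·)) (_ : Nonempty I)
    (D : I ⥤ Pf R),
    (∀ i : I, ∃ (j : I) (hij : i ≤ j), ∀ (k : I) (hjk : j ≤ k),
      dualImage (D.map (homOfLE (hij.trans hjk))).hom = dualImage (D.map (homOfLE hij)).hom) ∧
    Nonempty (M ≅ colimit (D ⋙ (isFGProjective R).ι))

/-- `κ`-generated modules: those generated by at most `κ` elements. -/
def isGeneratedBy (κ : Cardinal.{u}) : ObjectProperty (ModuleCat.{u} R) := fun M =>
  ∃ s : Set M, Cardinal.mk s ≤ κ ∧ Submodule.span R s = ⊤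

/-- `FM(R)` -/
abbrev FMMod := (isFlatMittagLeffler R).FullSubcategory

/-- `FM_κ(R)` -/
abbrev FMModOfSize (κ : Cardinal.{u}) :=
  (isFlatMittagLeffler R ⊓ isGeneratedBy R κ).FullSubcategory

/-- `M` is the union of a directed system of finitely generated projective submodules, all of
whose inclusions split. -/
def IsDirectedUnionOfSplitFGProjectives (M : Type u) [AddCommGroup M] [Module R M] : Prop :=
  ∃ (I : Type u) (_ : PartialOrder I) (_ : IsDirected I (· ≤ ·)) (_ : Nonempty I)
    (P : I →o Submodule R M),
    (∀ i, Module.Finite R (P i) ∧ Module.Projective R (P i)) ∧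
    (∀ (i j : I) (h : i ≤ j), ∃ r : P j →ₗ[R] P i,
      r ∘ₗ Submodule.inclusion (P.monotone h) = LinearMap.id) ∧
    ∀ x : M, ∃ i, x ∈ P i

end Modules

end AdmissibleInd

open CategoryTheory AdmissibleInd

namespace AdmissibleInd

open CategoryTheory CategoryTheory.Limits Opposite

/-! ### Idempotent completions and retracts -/

section Karoubi

open Idempotents

variable {C : Type*} {D : Type*} [Category* C] [Category* D]

/-! The functor `M ↦ Hom_R(-, M)` into left exact presheaves is fully faithful and commutes with
directed colimits, so an admissible Ind-object is `Hom_R(-, M)` with `M` a directed colimit of split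
monics in `P_f(R)`. Such an `M` is flat Mittag-Leffler, all dual maps being surjective. The
equivalences then follow formally (`exists_karoubi_equivalence`) from two facts: flat Mittag-Leffler
modules are closed under retracts, and each is a retract of one whose presheaf is admissible, namely
`M ⊕ R^(ω)`.

The core is the splitting of `M ⊕ R^(ω)`. Stabilization of the dual images yields a condition on `M`
alone, `HasUniversalFactorizations`: the inclusion of a finitely generated `X` is `X → R^n → M`,
where the first map extends to every larger finitely generated submodule. Composing such data gives
an endomorphism `e` of `R^n` that fixes the image of `X`. The map `R^n → M` need not be a split
monic, but it becomes one once `1 - e` is recorded in unused coordinates of `R^(ω)`: the part `e` is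
recovered from `M`, the part `1 - e` from the free summand
(`HasUniversalFactorizations.exists_isLocallySplit`).

For closure under retracts, the image of an idempotent `e` on a union of a split system is the
colimit of the same submodules with `e` as transition map
(`SplitSystem.isFlatMittagLeffler_of_retract`). For the bound `κ`, a split system is reindexed by
the finite subsets of a generating set (`SplitSystem.exists_mk_le`). -/

theorem functorExtension₂_full (G : C ⥤ D) [G.Full] [G.Faithful] :
    ((functorExtension₂ C D).obj G).Full where
  map_surjective {P Q} f := by
    obtain ⟨g, hg⟩ := G.map_surjective (X := P.X) (Y := Q.X) f.f
    refine ⟨⟨g, G.map_injective ?_⟩, Karoubi.hom_ext _ _ hg⟩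
    rw [Functor.map_comp, Functor.map_comp, hg]
    exact f.comm

theorem functorExtension₂_faithful (G : C ⥤ D) [G.Faithful] :
    ((functorExtension₂ C D).obj G).Faithful where
  map_injective {P Q} f g h := by
    have := congrArg Karoubi.Hom.f h
    exact Karoubi.hom_ext _ _ (G.map_injective this)

/-- An idempotent on a retract of `G.obj Y` is transported to an idempotent of `G.obj Y` with the
same image, and this lifts along the fully faithful `G`. -/
theorem functorExtension₂_essSurj (G : C ⥤ D) [G.Full] [G.Faithful]
    (h : ∀ X : D, ∃ Y : C, Nonempty (Retract X (G.obj Y))) :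
    ((functorExtension₂ C D).obj G).EssSurj where
  mem_essImage P := by
    obtain ⟨Y, ⟨r⟩⟩ := h P.X
    obtain ⟨q, hq⟩ := G.map_surjective (r.r ≫ P.p ≫ r.i)
    have h1 : q ≫ q = q := G.map_injective (by simp [hq])
    have h2 : G.map q ≫ (r.r ≫ P.p) ≫ P.p = r.r ≫ P.p := by simp [hq]
    have h3 : P.p ≫ (P.p ≫ r.i) ≫ G.map q = P.p ≫ r.i := by simp [hq]
    have h4 : (r.r ≫ P.p) ≫ P.p ≫ r.i = G.map q := by simp [hq]
    have h5 : (P.p ≫ r.i) ≫ r.r ≫ P.p = P.p := by simp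
    exact ⟨⟨Y, q, h1⟩, ⟨⟨⟨r.r ≫ P.p, h2⟩, ⟨P.p ≫ r.i, h3⟩, Karoubi.hom_ext _ _ h4,
      Karoubi.hom_ext _ _ h5⟩⟩⟩

/-- If a fully faithful functor exhibits every object of an idempotent complete category as a
retract of an object in its image, then that category is the idempotent completion of the source. -/
theorem exists_karoubi_equivalence_of_retract [IsIdempotentComplete D] (G : C ⥤ D) [G.Full]
    [G.Faithful] (h : ∀ X : D, ∃ Y : C, Nonempty (Retract X (G.obj Y))) :
    ∃ e : Karoubi C ≌ D, Nonempty (toKaroubi C ⋙ e.functor ≅ G) := by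
  have := functorExtension₂_full G
  have := functorExtension₂_faithful G
  have := functorExtension₂_essSurj G h
  have : ((functorExtension₂ C D).obj G).IsEquivalence := {}
  refine ⟨((functorExtension₂ C D).obj G).asEquivalence.trans (toKaroubiEquivalence D).symm,
    ⟨?_⟩⟩
  exact Functor.isoWhiskerRight ((functorExtension₂CompWhiskeringLeftToKaroubiIso C D).app G)
      (toKaroubiEquivalence D).inverse ≪≫
    Functor.isoWhiskerLeft G (toKaroubiEquivalence D).unitIso.symm

variable {E : Type*} [Category* E]

/-- Two full subcategories related by a fully faithful functor up to retracts have the same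
idempotent completion. -/
theorem exists_karoubi_equivalence (Φ : D ⥤ E) [Φ.Full] [Φ.Faithful] (A : ObjectProperty E)
    (F : ObjectProperty D) [IsIdempotentComplete D]
    (hF : ∀ X Y : D, Retract X Y → F Y → F X)
    (hA : ∀ Y, A Y → ∃ X, F X ∧ Nonempty (Φ.obj X ≅ Y))
    (hr : ∀ X, F X → ∃ Y, F Y ∧ A (Φ.obj Y) ∧ Nonempty (Retract X Y)) :
    ∃ e : Karoubi A.FullSubcategory ≌ F.FullSubcategory,
      Nonempty (toKaroubi A.FullSubcategory ⋙ e.functor ⋙ F.ι ⋙ Φ ≅ A.ι) := by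
  -- An idempotent splits in the ambient category, and its image is a retract, hence stays in `F`.
  have : IsIdempotentComplete F.FullSubcategory := ⟨fun X p hp => by
    obtain ⟨Y, i, q, h1, h2⟩ := IsIdempotentComplete.idempotents_split X.obj p.hom
      (congrArg InducedCategory.Hom.hom hp)
    exact ⟨⟨Y, hF _ _ ⟨i, q, h1⟩ X.property⟩, ObjectProperty.homMk i, ObjectProperty.homMk q,
      by ext; exact h1, by ext; exact h2⟩⟩
  have hess : ∀ Y : A.FullSubcategory, (F.ι ⋙ Φ).essImage (A.ι.obj Y) := fun Y => by
    obtain ⟨X, hX, ⟨i⟩⟩ := hA Y.obj Y.property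
    exact ⟨⟨X, hX⟩, ⟨i⟩⟩
  let G := Functor.essImage.liftFunctor A.ι (F.ι ⋙ Φ) hess
  let iG : G ⋙ F.ι ⋙ Φ ≅ A.ι := Functor.essImage.liftFunctorCompIso A.ι (F.ι ⋙ Φ) hess
  have : (G ⋙ F.ι ⋙ Φ).Full := Functor.Full.of_iso iG.symm
  have : (G ⋙ F.ι ⋙ Φ).Faithful := Functor.Faithful.of_iso iG.symm
  have : G.Faithful := Functor.Faithful.of_comp G (F.ι ⋙ Φ)
  have : G.Full := Functor.Full.of_comp_faithful G (F.ι ⋙ Φ)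
  obtain ⟨e, ⟨i⟩⟩ := exists_karoubi_equivalence_of_retract G fun X => by
    obtain ⟨Y, hY, hYA, ⟨r⟩⟩ := hr X.obj X.property
    let j : (⟨Y, hY⟩ : F.FullSubcategory) ≅ G.obj ⟨Φ.obj Y, hYA⟩ :=
      (F.ι ⋙ Φ).preimageIso (iG.app ⟨Φ.obj Y, hYA⟩).symm
    refine ⟨⟨Φ.obj Y, hYA⟩, ⟨⟨ObjectProperty.homMk r.i ≫ j.hom,
      j.inv ≫ ObjectProperty.homMk r.r, ?_⟩⟩⟩
    rw [Category.assoc, j.hom_inv_id_assoc]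
    ext
    exact r.retract
  exact ⟨e, ⟨Functor.isoWhiskerRight i (F.ι ⋙ Φ) ≪≫ iG⟩⟩

end Karoubi

/-! ### Universal factorizations and locally split submodules -/

section SplitSubmodules

variable {R : Type*} [Ring R]

section General

variable {M : Type*} [AddCommGroup M] [Module R M]

theorem exists_comp_rangeRestrict_eq {P Q : Type*} [AddCommGroup P] [Module R P] [AddCommGroup Q]
    [Module R Q] (f : P →ₗ[R] M) (w : P →ₗ[R] Q) (h : LinearMap.ker f ≤ LinearMap.ker w) :
    ∃ v : LinearMap.range f →ₗ[R] Q, v ∘ₗ f.rangeRestrict = w := by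
  refine ⟨(LinearMap.ker f).liftQ w h ∘ₗ f.quotKerEquivRange.symm.toLinearMap, ?_⟩
  ext p
  have : f.quotKerEquivRange.symm (f.rangeRestrict p) = (LinearMap.ker f).mkQ p :=
    f.quotKerEquivRange.symm_apply_eq.mpr rfl
  simp [this]

theorem exists_le_of_fg_of_directed {I : Type*} [Preorder I] [IsDirected I (· ≤ ·)] [Nonempty I]
    (F : I →o Submodule R M) (hF : ∀ x, ∃ i, x ∈ F i) {X : Submodule R M} (hX : X.FG) :
    ∃ i, X ≤ F i := by
  induction X, hX using Submodule.fg_induction with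
  | singleton x =>
    obtain ⟨i, hi⟩ := hF x
    exact ⟨i, by simpa using hi⟩
  | sup X Y hX hY hX' hY' =>
    obtain ⟨i, hi⟩ := hX'
    obtain ⟨j, hj⟩ := hY'
    obtain ⟨k, hik, hjk⟩ := exists_ge_ge i j
    exact ⟨k, sup_le (hi.trans (F.monotone hik)) (hj.trans (F.monotone hjk))⟩

variable (R M) in
/-- Every inclusion of a finitely generated submodule factors through a finite free module by a
map that extends to all larger finitely generated submodules. -/
def HasUniversalFactorizations : Prop :=
  ∀ X : Submodule R M, X.FG → ∃ (n : ℕ) (u : X →ₗ[R] (Fin n → R)) (g : (Fin n → R) →ₗ[R] M),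
    g ∘ₗ u = X.subtype ∧ ∀ (K : Submodule R M) (h : X ≤ K), K.FG →
      ∃ v : K →ₗ[R] (Fin n → R), v ∘ₗ Submodule.inclusion h = u

/-- A finitely generated projective submodule that is a direct summand in every larger finitely
generated submodule. -/
structure IsLocallySplit (F : Submodule R M) : Prop where
  fg : F.FG
  projective : Module.Projective R F
  exists_retraction : ∀ (K : Submodule R M) (h : F ≤ K), K.FG →
    ∃ r : K →ₗ[R] F, r ∘ₗ Submodule.inclusion h = LinearMap.id

/-- Left inverses of `α` may depend on `K`. The case where `K` is the range already makes `α`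
injective, so the range is projective. -/
theorem isLocallySplit_range {P : Type*} [AddCommGroup P] [Module R P] [Module.Finite R P]
    [Module.Projective R P] (α : P →ₗ[R] M)
    (h : ∀ K : Submodule R M, K.FG → LinearMap.range α ≤ K →
      ∃ ρ : K →ₗ[R] P, ∀ (p : P) (hp : α p ∈ K), ρ ⟨α p, hp⟩ = p) :
    IsLocallySplit (LinearMap.range α) := by
  have hfg : (LinearMap.range α).FG := Module.Finite.iff_fg.mp inferInstance
  have hinj : Function.Injective α := by
    obtain ⟨ρ, hρ⟩ := h _ hfg le_rfl
    intro p q hpq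
    rw [← hρ p ⟨p, rfl⟩, ← hρ q ⟨q, rfl⟩]
    congr 2
  refine ⟨hfg, Module.Projective.of_equiv (LinearEquiv.ofInjective α hinj), fun K hK hKfg => ?_⟩
  obtain ⟨ρ, hρ⟩ := h K hKfg hK
  refine ⟨α.rangeRestrict ∘ₗ ρ, ?_⟩
  ext ⟨_, p, rfl⟩
  exact congrArg α (hρ p _)

end General

/-- The inclusion of `R ^ m` into `R ^ (ω)` on the coordinates `s, ..., s + m - 1`. -/
noncomputable def shiftIncl (R : Type*) [Ring R] (s m : ℕ) : (Fin m → R) →ₗ[R] (ℕ →₀ R) :=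
  Finsupp.lmapDomain R R (fun i : Fin m => s + i) ∘ₗ
    (Finsupp.linearEquivFunOnFinite R R (Fin m)).symm.toLinearMap

/-- The projection of `R ^ (ω)` onto the coordinates `s, ..., s + m - 1`. -/
noncomputable def shiftProj (R : Type*) [Ring R] (s m : ℕ) : (ℕ →₀ R) →ₗ[R] (Fin m → R) :=
  LinearMap.pi fun i => Finsupp.lapply (s + i)

theorem shiftIncl_apply_add (s m : ℕ) (q : Fin m → R) (i : Fin m) :
    shiftIncl R s m q (s + i) = q i := by
  have hinj : Function.Injective fun i : Fin m => s + (i : ℕ) := fun a b h => by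
    simpa [Fin.ext_iff] using h
  simpa [shiftIncl] using
    Finsupp.mapDomain_apply hinj ((Finsupp.linearEquivFunOnFinite R R (Fin m)).symm q) i

theorem shiftIncl_apply_eq_zero (s m : ℕ) (q : Fin m → R) (j : ℕ) (h : j < s ∨ s + m ≤ j) :
    shiftIncl R s m q j = 0 := by
  refine Finsupp.mapDomain_of_notMem_range _ _ ?_
  rintro ⟨i, hi⟩
  have := i.2
  dsimp only at hi
  omega

@[simp]
theorem shiftProj_shiftIncl (s m : ℕ) (q : Fin m → R) :
    shiftProj R s m (shiftIncl R s m q) = q :=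
  funext fun i => shiftIncl_apply_add s m q i

@[simp]
theorem shiftProj_shiftIncl_of_le {s m s' m' : ℕ} (h : s + m ≤ s' ∨ s' + m' ≤ s) (q : Fin m → R) :
    shiftProj R s' m' (shiftIncl R s m q) = 0 :=
  funext fun i => shiftIncl_apply_eq_zero s m q _ (by have := i.2; omega)

theorem exists_shiftIncl_shiftProj_eq {M : Type*} [AddCommGroup M] [Module R M]
    {X : Submodule R (M × (ℕ →₀ R))} (hX : X.FG) :
    ∃ k, ∀ z ∈ X, shiftIncl R 0 k (shiftProj R 0 k z.2) = z.2 := by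
  obtain ⟨S, rfl⟩ := hX
  obtain ⟨k, hk⟩ := Finset.exists_nat_subset_range (S.biUnion fun z => z.2.support)
  refine ⟨k, fun z hz => ?_⟩
  let F : Submodule R (M × (ℕ →₀ R)) :=
    LinearMap.eqLocus (shiftIncl R 0 k ∘ₗ shiftProj R 0 k ∘ₗ LinearMap.snd R M (ℕ →₀ R))
      (LinearMap.snd R M (ℕ →₀ R))
  refine (Submodule.span_le (p := F)).mpr (fun y hy => ?_) hz
  ext j
  by_cases hj : j < k
  · have h := shiftIncl_apply_add 0 k (shiftProj R 0 k y.2) ⟨j, hj⟩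
    simp only [zero_add] at h
    exact h.trans (by simp [shiftProj])
  · refine (shiftIncl_apply_eq_zero 0 k _ j (by omega)).trans ?_
    by_contra h
    exact hj (Finset.mem_range.mp (hk (Finset.mem_biUnion.mpr
      ⟨y, hy, Finsupp.mem_support_iff.mpr (Ne.symm h)⟩)))

variable {M : Type*} [AddCommGroup M] [Module R M]

/-- The free summand repairs the failure of `g₀ : R^n → M` to be split: the first `k` coordinates
absorb the second components of `X`, and the next `n` hold the defect `1 - e`. Universality is used
twice, for the projection of `X` to `M` and then for the range of `g₀`. -/
theorem HasUniversalFactorizations.exists_isLocallySplit (hM : HasUniversalFactorizations R M)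
    (X : Submodule R (M × (ℕ →₀ R))) (hX : X.FG) :
    ∃ F : Submodule R (M × (ℕ →₀ R)), IsLocallySplit F ∧ X ≤ F := by
  obtain ⟨k, hk⟩ := exists_shiftIncl_shiftProj_eq hX
  let X₀ := X.map (LinearMap.fst R M (ℕ →₀ R))
  obtain ⟨n, u₀, g₀, hgu₀, hu₀⟩ := hM X₀ (hX.map _)
  have hfg₁ : (LinearMap.range g₀).FG := Module.Finite.iff_fg.mp inferInstance
  obtain ⟨m, u₁, g₁, hgu₁, hu₁⟩ := hM (LinearMap.range g₀) hfg₁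
  have h01 : X₀ ≤ LinearMap.range g₀ := fun x hx => ⟨u₀ ⟨x, hx⟩, LinearMap.congr_fun hgu₀ ⟨x, hx⟩⟩
  have h12 : LinearMap.range g₀ ≤ LinearMap.range g₁ := fun x hx =>
    ⟨u₁ ⟨x, hx⟩, LinearMap.congr_fun hgu₁ ⟨x, hx⟩⟩
  obtain ⟨v, hv⟩ := hu₀ (LinearMap.range g₁) (h01.trans h12) (Module.Finite.iff_fg.mp inferInstance)
  -- `e` is `v ∘ g₀`; it need not be idempotent. It fixes the image of `u₀`, because `g₀ ∘ u₀` is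
  -- the inclusion and `v` extends `u₀`.
  let e : (Fin n → R) →ₗ[R] (Fin n → R) := v ∘ₗ Submodule.inclusion h12 ∘ₗ g₀.rangeRestrict
  let α : (Fin n → R) × (Fin k → R) →ₗ[R] M × (ℕ →₀ R) :=
    LinearMap.prod (g₀ ∘ₗ LinearMap.fst R _ _)
      ((shiftIncl R 0 k).comp (LinearMap.snd R _ _) +
        (shiftIncl R k n) ∘ₗ (LinearMap.id - e) ∘ₗ LinearMap.fst R _ _)
  refine ⟨LinearMap.range α, isLocallySplit_range α fun K hK hKα => ?_, ?_⟩
  · obtain ⟨w, hw⟩ := hu₁ (K.map (LinearMap.fst R M (ℕ →₀ R))) (by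
      rintro _ ⟨q, rfl⟩
      exact ⟨_, hKα ⟨(q, 0), rfl⟩, rfl⟩) (hK.map _)
    -- On `α (q, r)` the first summand reads off `q - e q`. The second gives `v (g₁ (u₁ (g₀ q))) = v
    -- (g₀ q) = e q`, as `w` extends `u₁`.
    let ρ₁ : K →ₗ[R] (Fin n → R) :=
      shiftProj R k n ∘ₗ LinearMap.snd R M (ℕ →₀ R) ∘ₗ K.subtype +
        v ∘ₗ g₁.rangeRestrict ∘ₗ w ∘ₗ (LinearMap.fst R M (ℕ →₀ R)).submoduleMap K
    let ρ₂ : K →ₗ[R] (Fin k → R) := shiftProj R 0 k ∘ₗ LinearMap.snd R M (ℕ →₀ R) ∘ₗ K.subtype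
    refine ⟨LinearMap.prod ρ₁ ρ₂, fun p hp => Prod.ext ?_ ?_⟩
    · have h1 : w ((LinearMap.fst R M (ℕ →₀ R)).submoduleMap K ⟨α p, hp⟩) =
          u₁ (g₀.rangeRestrict p.1) := LinearMap.congr_fun hw (g₀.rangeRestrict p.1)
      have h2 : g₁.rangeRestrict (u₁ (g₀.rangeRestrict p.1)) =
          Submodule.inclusion h12 (g₀.rangeRestrict p.1) :=
        Subtype.ext (LinearMap.congr_fun hgu₁ (g₀.rangeRestrict p.1))
      have h3 : shiftProj R k n (α p).2 = p.1 - e p.1 := by simp [α]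
      change shiftProj R k n (α p).2 + v (g₁.rangeRestrict (w _)) = p.1
      rw [h3, h1, h2]
      exact sub_add_cancel _ _
    · change shiftProj R 0 k (α p).2 = p.2
      simp [α]
  · intro z hz
    have hz₀ : z.1 ∈ X₀ := ⟨z, hz, rfl⟩
    have h1 : g₀ (u₀ ⟨z.1, hz₀⟩) = z.1 := LinearMap.congr_fun hgu₀ ⟨z.1, hz₀⟩
    have h2 : e (u₀ ⟨z.1, hz₀⟩) = u₀ ⟨z.1, hz₀⟩ := by
      refine Eq.trans ?_ (LinearMap.congr_fun hv ⟨z.1, hz₀⟩)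
      exact congrArg v (Subtype.ext h1)
    -- The defect term vanishes here since `e` fixes `u₀ z.1`.
    refine ⟨(u₀ ⟨z.1, hz₀⟩, shiftProj R 0 k z.2), Prod.ext h1 ?_⟩
    simp [α, h2, hk z hz]

end SplitSubmodules

/-- The system consists of all locally split submodules. Inclusions between them split
automatically, the larger one being finitely generated. -/
theorem HasUniversalFactorizations.isDirectedUnion {R : Type u} [Ring R] {M : Type u}
    [AddCommGroup M] [Module R M] (hM : HasUniversalFactorizations R M) :
    IsDirectedUnionOfSplitFGProjectives R (M × (ℕ →₀ R)) := by
  refine ⟨{F : Submodule R (M × (ℕ →₀ R)) // IsLocallySplit F}, inferInstance, ⟨fun F G => ?_⟩, ?_,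
    ⟨Subtype.val, fun _ _ h => h⟩, fun F => ⟨Module.Finite.iff_fg.mpr F.2.fg, F.2.projective⟩,
    fun F G h => F.2.exists_retraction _ h G.2.fg, fun x => ?_⟩
  · obtain ⟨K, hK, h⟩ := hM.exists_isLocallySplit (F.1 ⊔ G.1) (F.2.fg.sup G.2.fg)
    exact ⟨⟨K, hK⟩, le_sup_left.trans h, le_sup_right.trans h⟩
  · obtain ⟨K, hK, -⟩ := hM.exists_isLocallySplit ⊥ Submodule.fg_bot
    exact ⟨⟨K, hK⟩⟩
  · obtain ⟨K, hK, h⟩ := hM.exists_isLocallySplit (R ∙ x) (Submodule.fg_span_singleton x)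
    exact ⟨⟨K, hK⟩, h (Submodule.mem_span_singleton_self x)⟩

/-- It suffices to treat a cofinal family of finitely generated submodules: restrict `u` to `X`, and
extend it to `K` by way of `Y ⊔ K`. -/
theorem HasUniversalFactorizations.of_le {R M : Type*} [Ring R] [AddCommGroup M] [Module R M]
    (h : ∀ X : Submodule R M, X.FG → ∃ (Y : Submodule R M) (n : ℕ) (u : Y →ₗ[R] (Fin n → R))
      (g : (Fin n → R) →ₗ[R] M), X ≤ Y ∧ Y.FG ∧ g ∘ₗ u = Y.subtype ∧
        ∀ (K : Submodule R M) (h : Y ≤ K), K.FG →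
          ∃ v : K →ₗ[R] (Fin n → R), v ∘ₗ Submodule.inclusion h = u) :
    HasUniversalFactorizations R M := by
  intro X hX
  obtain ⟨Y, n, u, g, hXY, hY, hgu, hu⟩ := h X hX
  refine ⟨n, u ∘ₗ Submodule.inclusion hXY, g, ?_, fun K hK hKfg => ?_⟩
  · ext x
    exact LinearMap.congr_fun hgu (Submodule.inclusion hXY x)
  · obtain ⟨v, hv⟩ := hu (Y ⊔ K) le_sup_left (hY.sup hKfg)
    refine ⟨v ∘ₗ Submodule.inclusion le_sup_right, ?_⟩
    rw [← hv]
    rfl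

/-! ### From stabilizing dual images to universal factorizations -/

section System

variable {R M : Type*} [Ring R] [AddCommGroup M] [Module R M]

variable {I : Type*} [Preorder I] [IsDirected I (· ≤ ·)] [Nonempty I]
  {P : I → Type*} [∀ i, AddCommGroup (P i)] [∀ i, Module R (P i)]
  [∀ i, Module.Finite R (P i)] [∀ i, Module.Projective R (P i)]

/-- A directed colimit of finitely generated projective modules has universal factorizations if
the images of the dual maps stabilize. -/
theorem hasUniversalFactorizations_of_system (t : ∀ {i j : I}, i ≤ j → P i →ₗ[R] P j)
    (f : ∀ i, P i →ₗ[R] M)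
    (ht : ∀ {i j k : I} (hij : i ≤ j) (hjk : j ≤ k), t hjk ∘ₗ t hij = t (hij.trans hjk))
    (hf : ∀ {i j : I} (h : i ≤ j), f j ∘ₗ t h = f i)
    (hsurj : ∀ x, ∃ i, x ∈ LinearMap.range (f i))
    (hker : ∀ i p, f i p = 0 → ∃ (j : I) (h : i ≤ j), t h p = 0)
    (hml : ∀ i, ∃ (j : I) (hij : i ≤ j), ∀ (k : I) (hjk : j ≤ k) (φ : P j →ₗ[R] R),
      ∃ ψ : P k →ₗ[R] R, ψ ∘ₗ t (hij.trans hjk) = φ ∘ₗ t hij) :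
    HasUniversalFactorizations R M := by
  -- Write `P j` as a summand of `R^n`. Stabilization, applied to each coordinate functional, shows
  -- that `P i → P j → R^n` extends over every later `P k`.
  have hml' (i : I) : ∃ (j : I) (hij : i ≤ j) (n : ℕ) (a : P j →ₗ[R] (Fin n → R))
      (b : (Fin n → R) →ₗ[R] P j), b ∘ₗ a = LinearMap.id ∧ ∀ (k : I) (hjk : j ≤ k),
        ∃ ρ : P k →ₗ[R] (Fin n → R), ρ ∘ₗ t (hij.trans hjk) = a ∘ₗ t hij := by
    obtain ⟨j, hij, h⟩ := hml i
    obtain ⟨n, b, hb⟩ := Module.Finite.exists_fin' R (P j)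
    obtain ⟨a, ha⟩ := Module.projective_lifting_property b LinearMap.id hb
    refine ⟨j, hij, n, a, b, ha, fun k hjk => ?_⟩
    choose ψ hψ using fun s : Fin n => h k hjk (LinearMap.proj s ∘ₗ a)
    exact ⟨LinearMap.pi ψ, LinearMap.ext fun p => funext fun s => LinearMap.congr_fun (hψ s) p⟩
  -- One stage kills the whole kernel: if `p` dies at a later stage, the extension property gives `a
  -- (t hij p) = 0`, and `a` is injective.
  have hker' (i : I) : ∃ (j : I) (hij : i ≤ j),
      LinearMap.ker (f i) ≤ LinearMap.ker (t hij) := by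
    obtain ⟨j, hij, n, a, b, hba, h⟩ := hml' i
    refine ⟨j, hij, fun p hp => ?_⟩
    obtain ⟨k, hik, hk⟩ := hker i p hp
    obtain ⟨l, hjl, hkl⟩ := exists_ge_ge j k
    obtain ⟨ρ, hρ⟩ := h l hjl
    have h1 : t (hij.trans hjl) p = 0 := by
      rw [← LinearMap.congr_fun (ht hik hkl) p, LinearMap.comp_apply, hk, map_zero]
    have h2 : a (t hij p) = 0 := by
      rw [← LinearMap.comp_apply, ← hρ, LinearMap.comp_apply, h1, map_zero]
    rw [LinearMap.mem_ker, ← LinearMap.id_apply (R := R) (t hij p), ← hba, LinearMap.comp_apply,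
      h2, map_zero]
  let F : I →o Submodule R M := ⟨fun i => LinearMap.range (f i), fun i j h => by
    change LinearMap.range (f i) ≤ LinearMap.range (f j)
    rw [← hf h]
    exact LinearMap.range_comp_le_range _ _⟩
  refine HasUniversalFactorizations.of_le fun X hX => ?_
  obtain ⟨i, hi⟩ := exists_le_of_fg_of_directed F hsurj hX
  obtain ⟨j, hij, n, a, b, hba, h⟩ := hml' i
  -- Extending first to a stage `m` where the kernel of `f l` has died makes `ρ` descend to the
  -- range of `f l`.
  have hext (l : I) (hjl : j ≤ l) : ∃ ρ : P l →ₗ[R] (Fin n → R),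
      ρ ∘ₗ t (hij.trans hjl) = a ∘ₗ t hij ∧ LinearMap.ker (f l) ≤ LinearMap.ker ρ := by
    obtain ⟨m, hlm, hm⟩ := hker' l
    obtain ⟨ρ, hρ⟩ := h m (hjl.trans hlm)
    refine ⟨ρ ∘ₗ t hlm, ?_, fun p hp => ?_⟩
    · rw [LinearMap.comp_assoc, ht, hρ]
    · rw [LinearMap.mem_ker, LinearMap.comp_apply, LinearMap.mem_ker.mp (hm hp), map_zero]
  have hi0 : LinearMap.ker (f i) ≤ LinearMap.ker (a ∘ₗ t hij) := by
    obtain ⟨ρ, hρ, hk⟩ := hext j le_rfl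
    intro p hp
    rw [← hρ, LinearMap.mem_ker, LinearMap.comp_apply]
    refine LinearMap.mem_ker.mp (hk ?_)
    rw [LinearMap.mem_ker, ← LinearMap.comp_apply, hf]
    exact hp
  obtain ⟨u, hu⟩ := exists_comp_rangeRestrict_eq (f i) _ hi0
  refine ⟨LinearMap.range (f i), n, u, f j ∘ₗ b, hi, Module.Finite.iff_fg.mp inferInstance, ?_,
    fun K hK hKfg => ?_⟩
  · ext ⟨_, p, rfl⟩
    have h1 : u ⟨f i p, p, rfl⟩ = a (t hij p) := LinearMap.congr_fun hu p
    have h2 : b (a (t hij p)) = t hij p := LinearMap.congr_fun hba _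
    simp only [LinearMap.comp_apply, h1, h2]
    exact LinearMap.congr_fun (hf hij) p
  · obtain ⟨k, hk⟩ := exists_le_of_fg_of_directed F hsurj hKfg
    obtain ⟨l, hjl, hkl⟩ := exists_ge_ge j k
    obtain ⟨ρ, hρ, hρk⟩ := hext l hjl
    obtain ⟨v, hv⟩ := exists_comp_rangeRestrict_eq (f l) ρ hρk
    refine ⟨v ∘ₗ Submodule.inclusion (hk.trans (F.monotone hkl)), ?_⟩
    ext1 ⟨_, p, rfl⟩
    have h1 : u ⟨f i p, p, rfl⟩ = a (t hij p) := LinearMap.congr_fun hu p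
    rw [h1, ← LinearMap.comp_apply, ← hρ, ← hv]
    refine congrArg v (Subtype.ext ?_)
    exact (LinearMap.congr_fun (hf (hij.trans hjl)) p).symm

end System

/-! ### Directed colimits of modules -/

section Colimits

variable {R : Type u} [Ring R] {I : Type u} [PartialOrder I] [IsDirected I (· ≤ ·)] [Nonempty I]

theorem exists_rep_of_isColimit {D : I ⥤ ModuleCat.{u} R} {c : Cocone D} (hc : IsColimit c)
    (x : c.pt) : ∃ (i : I) (y : D.obj i), c.ι.app i y = x :=
  Concrete.isColimit_exists_rep D hc x

theorem exists_map_eq_zero_of_isColimit {D : I ⥤ ModuleCat.{u} R} {c : Cocone D}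
    (hc : IsColimit c) {i : I} (y : D.obj i) (h : c.ι.app i y = 0) :
    ∃ (j : I) (hij : i ≤ j), D.map (homOfLE hij) y = 0 := by
  obtain ⟨j, f, g, hfg⟩ :=
    Concrete.isColimit_exists_of_rep_eq D hc y (0 : D.obj i) (by simpa using h)
  rw [map_zero] at hfg
  exact ⟨j, leOfHom f, hfg⟩

theorem isFlatMittagLeffler.hasUniversalFactorizations {M : ModuleCat.{u} R}
    (hM : isFlatMittagLeffler R M) : HasUniversalFactorizations R M := by
  obtain ⟨I, _, _, _, D, hD, ⟨e⟩⟩ := hM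
  let c : Cocone (D ⋙ (isFGProjective R).ι) := (Cocone.extend (colimit.cocone _) e.inv)
  have hc : IsColimit c := IsColimit.extendIso e.inv (colimit.isColimit _)
  refine hasUniversalFactorizations_of_system (P := fun i => (D.obj i).obj)
    (fun {i j} h => (D.map (homOfLE h)).hom.hom) (fun i => (c.ι.app i).hom) ?_ ?_ ?_ ?_ ?_
  · intro i j k hij hjk
    rw [← homOfLE_comp hij hjk, D.map_comp]
    rfl
  · intro i j h
    exact congrArg ModuleCat.Hom.hom (c.w (homOfLE h))
  · exact fun x => exists_rep_of_isColimit hc x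
  · exact fun i p h => exists_map_eq_zero_of_isColimit hc p h
  · intro i
    obtain ⟨j, hij, h⟩ := hD i
    refine ⟨j, hij, fun k hjk φ => ?_⟩
    have : φ ∘ₗ (D.map (homOfLE hij)).hom.hom ∈ dualImage (D.map (homOfLE hij)).hom := ⟨φ, rfl⟩
    rw [← h k hjk] at this
    exact this

/-- A cocone of modules over a directed poset is a colimit cocone if it is jointly surjective and
elements of the kernels vanish at a later stage. -/
theorem nonempty_isColimit_of_directed {D : I ⥤ ModuleCat.{u} R} (c : Cocone D)
    (hsurj : ∀ x : c.pt, ∃ (i : I) (y : D.obj i), c.ι.app i y = x)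
    (hker : ∀ (i : I) (y : D.obj i), c.ι.app i y = 0 →
      ∃ (j : I) (hij : i ≤ j), D.map (homOfLE hij) y = 0) : Nonempty (IsColimit c) := by
  refine ⟨isColimitOfReflects (forget (ModuleCat.{u} R)) ?_⟩
  refine Types.FilteredColimit.isColimitOf' _ _ (fun x => ?_) (fun i y z h => ?_)
  · obtain ⟨i, y, rfl⟩ := hsurj x
    exact ⟨i, y, rfl⟩
  · have h0 : c.ι.app i (y - z : D.obj i) = 0 := by
      rw [map_sub]
      exact sub_eq_zero.mpr h
    obtain ⟨j, hij, hj⟩ := hker i _ h0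
    rw [map_sub] at hj
    exact ⟨j, homOfLE hij, sub_eq_zero.mp hj⟩

end Colimits

/-! ### Split systems of submodules -/

section SplitSystem

/-- A directed system of finitely generated projective submodules with split inclusions whose
union is the whole module. -/
structure SplitSystem (R : Type u) [Ring R] (M : Type u) [AddCommGroup M] [Module R M] where
  I : Type u
  [partialOrder : PartialOrder I]
  [isDirected : IsDirected I (· ≤ ·)]
  [nonempty : Nonempty I]
  P : I →o Submodule R M
  finite : ∀ i, Module.Finite R (P i)
  projective : ∀ i, Module.Projective R (P i)
  split : ∀ (i j : I) (h : i ≤ j), ∃ r : P j →ₗ[R] P i,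
    r ∘ₗ Submodule.inclusion (P.monotone h) = LinearMap.id
  exists_mem : ∀ x : M, ∃ i, x ∈ P i

namespace SplitSystem

attribute [instance] partialOrder isDirected nonempty finite projective

end SplitSystem

theorem isDirectedUnionOfSplitFGProjectives_iff {R : Type u} [Ring R] {M : Type u}
    [AddCommGroup M] [Module R M] :
    IsDirectedUnionOfSplitFGProjectives R M ↔ Nonempty (SplitSystem R M) := by
  constructor
  · rintro ⟨I, _, _, _, P, h1, h2, h3⟩
    exact ⟨⟨I, P, fun i => (h1 i).1, fun i => (h1 i).2, h2, h3⟩⟩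
  · rintro ⟨S⟩
    exact ⟨S.I, _, S.isDirected, S.nonempty, S.P, fun i => ⟨S.finite i, S.projective i⟩,
      S.split, S.exists_mem⟩

variable {R : Type u} [Ring R] {M : Type u} [AddCommGroup M] [Module R M]

/-! ### Retracts of unions of split systems -/

namespace SplitSystem

/-- The index set `I × ℕ`, with `(i, m) < (j, n)` if `m < n` and `P j` contains both `P i`
and its image under `e`. -/
structure RetractIndex (S : SplitSystem R M) (e : M →ₗ[R] M) where
  idx : S.I
  level : ℕ

variable {S : SplitSystem R M} {e : M →ₗ[R] M}

/-- The strict order on `RetractIndex`. -/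
def RetractIndex.Lt (x y : S.RetractIndex e) : Prop :=
  x.level < y.level ∧ S.P x.idx ≤ S.P y.idx ∧ (S.P x.idx).map e ≤ S.P y.idx

theorem RetractIndex.Lt.ne {x y : S.RetractIndex e} (h : x.Lt y) : x ≠ y := by
  rintro rfl
  exact lt_irrefl _ h.1

theorem RetractIndex.Lt.trans {x y z : S.RetractIndex e} (h : x.Lt y) (h' : y.Lt z) : x.Lt z :=
  ⟨h.1.trans h'.1, h.2.1.trans h'.2.1, h.2.2.trans h'.2.1⟩

/-- A functor must send the identity at `x` to the identity, yet `e` should be every other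
transition map. The level makes `Lt` irreflexive, even when `P i` is stable under `e`, and leaves
strictly larger indices above any two. -/
instance : PartialOrder (S.RetractIndex e) where
  le x y := x = y ∨ x.Lt y
  le_refl x := Or.inl rfl
  le_trans := by
    rintro x y z (rfl | h) (rfl | h')
    · exact Or.inl rfl
    · exact Or.inr h'
    · exact Or.inr h
    · exact Or.inr (h.trans h')
  le_antisymm := by
    rintro x y (rfl | h) (h' | h')
    · rfl
    · rfl
    · exact h'.symm
    · exact ((h.trans h').ne rfl).elim

theorem RetractIndex.exists_lt (x y : S.RetractIndex e) : ∃ z, x.Lt z ∧ y.Lt z := by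
  have hx : (S.P x.idx ⊔ (S.P x.idx).map e).FG :=
    have := Module.Finite.iff_fg.mp (S.finite x.idx)
    this.sup (this.map e)
  have hy : (S.P y.idx ⊔ (S.P y.idx).map e).FG :=
    have := Module.Finite.iff_fg.mp (S.finite y.idx)
    this.sup (this.map e)
  obtain ⟨k, hk⟩ := exists_le_of_fg_of_directed S.P S.exists_mem (hx.sup hy)
  simp only [sup_le_iff] at hk
  exact ⟨⟨k, max x.level y.level + 1⟩, ⟨by dsimp only; omega, hk.1.1, hk.1.2⟩,
    ⟨by dsimp only; omega, hk.2.1, hk.2.2⟩⟩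

instance : IsDirected (S.RetractIndex e) (· ≤ ·) :=
  ⟨fun x y => (RetractIndex.exists_lt x y).imp fun _ h => ⟨Or.inr h.1, Or.inr h.2⟩⟩

instance : Nonempty (S.RetractIndex e) := S.nonempty.map fun i => ⟨i, 0⟩

open Classical in
/-- The identity if `x = y`, and `e` otherwise. -/
noncomputable def retractEnd (x y : S.RetractIndex e) : M →ₗ[R] M :=
  if x = y then LinearMap.id else e

theorem retractEnd_self (x : S.RetractIndex e) : retractEnd x x = LinearMap.id := if_pos rfl

theorem RetractIndex.Lt.retractEnd_eq {x y : S.RetractIndex e} (h : x.Lt y) :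
    retractEnd x y = e := if_neg h.ne

theorem retractEnd_comp (he : e ∘ₗ e = e) {x y z : S.RetractIndex e} (h : x ≤ y) (h' : y ≤ z) :
    retractEnd y z ∘ₗ retractEnd x y = retractEnd x z := by
  obtain rfl | h := h
  · rw [retractEnd_self, LinearMap.comp_id]
  obtain rfl | h' := h'
  · rw [retractEnd_self, LinearMap.id_comp]
  rw [h.retractEnd_eq, h'.retractEnd_eq, (h.trans h').retractEnd_eq, he]

theorem retractEnd_mem {x y : S.RetractIndex e} (h : x ≤ y) (p : S.P x.idx) :
    retractEnd x y p ∈ S.P y.idx := by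
  obtain rfl | h := h
  · rw [retractEnd_self]
    exact p.2
  · rw [h.retractEnd_eq]
    exact h.2.2 ⟨p, p.2, rfl⟩

/-- The transition maps of the diagram whose colimit is the image of `e`. -/
noncomputable def retractMap {x y : S.RetractIndex e} (h : x ≤ y) :
    S.P x.idx →ₗ[R] S.P y.idx :=
  (retractEnd x y ∘ₗ (S.P x.idx).subtype).codRestrict _ (retractEnd_mem h)

/-- A diagram whose colimit is the image of the idempotent `e`. -/
noncomputable def retractDiagram (S : SplitSystem R M) (e : M →ₗ[R] M) (he : e ∘ₗ e = e) :
    S.RetractIndex e ⥤ Pf R where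
  obj x := ⟨ModuleCat.of R (S.P x.idx), S.finite x.idx, S.projective x.idx⟩
  map f := ObjectProperty.homMk (ModuleCat.ofHom (retractMap (leOfHom f)))
  map_id x := by
    ext p
    exact LinearMap.congr_fun (retractEnd_self x) p.1
  map_comp f g := by
    ext p
    exact (LinearMap.congr_fun (retractEnd_comp he (leOfHom f) (leOfHom g)) p.1).symm

/-- With `e = i ∘ p` as transition maps, the colimit is the image of `e`, that is, `N`. The dual
images at `x` stabilize at any `z` strictly above `x`: a map `φ ∘ e` with `φ` on `P z` extends to
later stages through a retraction of the inclusion of `P z`, which is not itself a transition map.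
-/
theorem isFlatMittagLeffler_of_retract (S : SplitSystem R M) (N : ModuleCat.{u} R)
    (i : N →ₗ[R] M) (p : M →ₗ[R] N) (h : p ∘ₗ i = LinearMap.id) : isFlatMittagLeffler R N := by
  have he : (i ∘ₗ p) ∘ₗ (i ∘ₗ p) = i ∘ₗ p := by
    rw [LinearMap.comp_assoc, ← LinearMap.comp_assoc _ _ p, h, LinearMap.id_comp]
  have hpe : p ∘ₗ i ∘ₗ p = p := by rw [← LinearMap.comp_assoc, h, LinearMap.id_comp]
  have hend {x y : S.RetractIndex (i ∘ₗ p)} (hxy : x ≤ y) : p ∘ₗ retractEnd x y = p := by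
    obtain rfl | hxy := hxy
    · rw [retractEnd_self, LinearMap.comp_id]
    · rw [hxy.retractEnd_eq, hpe]
  let D := S.retractDiagram (i ∘ₗ p) he
  refine ⟨S.RetractIndex (i ∘ₗ p), inferInstance, inferInstance, inferInstance, D, fun x => ?_, ?_⟩
  · obtain ⟨z, hxz, -⟩ := RetractIndex.exists_lt x x
    refine ⟨z, Or.inr hxz, fun w hzw => ?_⟩
    have hxw : x.Lt w := by
      obtain rfl | hzw := hzw
      · exact hxz
      · exact hxz.trans hzw
    have hP : S.P z.idx ≤ S.P w.idx := by
      obtain rfl | hzw := hzw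
      · exact le_rfl
      · exact hzw.2.1
    apply Set.Subset.antisymm
    · rintro _ ⟨φ, rfl⟩
      refine ⟨φ ∘ₗ (D.map (homOfLE hzw)).hom.hom, ?_⟩
      rw [← homOfLE_comp (Or.inr hxz) hzw, D.map_comp]
      rfl
    · rintro _ ⟨φ, rfl⟩
      obtain ⟨r, hr⟩ : ∃ r : S.P w.idx →ₗ[R] S.P z.idx,
          r ∘ₗ Submodule.inclusion hP = LinearMap.id := by
        obtain rfl | hzw := hzw
        · exact ⟨LinearMap.id, rfl⟩
        -- The order on `RetractIndex` compares submodules, not indices of `S`, so the retraction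
        -- comes from a common upper bound and is restricted to `P w`.
        · obtain ⟨k, hk, hk'⟩ := exists_ge_ge z.idx w.idx
          obtain ⟨r, hr⟩ := S.split _ _ hk
          refine ⟨r ∘ₗ Submodule.inclusion (S.P.monotone hk'), ?_⟩
          rw [← hr]
          rfl
      refine ⟨φ ∘ₗ r, LinearMap.ext fun y => ?_⟩
      refine congrArg φ (Eq.trans (congrArg r (Subtype.ext ?_))
        (LinearMap.congr_fun hr (retractMap (Or.inr hxz) y)))
      change retractEnd x w y.1 = retractEnd x z y.1
      rw [hxz.retractEnd_eq, hxw.retractEnd_eq]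
  · let c : Cocone (D ⋙ (isFGProjective R).ι) :=
      { pt := N
        ι :=
          { app := fun x => ModuleCat.ofHom (p ∘ₗ (S.P x.idx).subtype)
            naturality := fun x y f => by
              ext q
              exact LinearMap.congr_fun (hend (leOfHom f)) q.1 } }
    obtain ⟨hc⟩ := nonempty_isColimit_of_directed c (fun n => by
        obtain ⟨k, hk⟩ := S.exists_mem (i n)
        exact ⟨⟨k, 0⟩, ⟨i n, hk⟩, LinearMap.congr_fun h n⟩) (fun x y hy => by
        -- If `p y = 0` then `e y = i (p y) = 0`, so `y` vanishes at any strictly later stage.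
        obtain ⟨z, hxz, -⟩ := RetractIndex.exists_lt x x
        refine ⟨z, Or.inr hxz, Subtype.ext ?_⟩
        change retractEnd x z y.1 = 0
        rw [hxz.retractEnd_eq]
        exact (congrArg i hy).trans (map_zero i))
    exact ⟨hc.coconePointUniqueUpToIso (colimit.isColimit _)⟩

end SplitSystem

/-! ### The admissible diagram of a split system -/

/-- The kernel of `r` is a complement of the image of `f`, and a summand of `Q`, so it lies in
`P_f(R)`. -/
theorem isAdmissibleMono_pf_of_retraction {P Q : Pf R} (f : P ⟶ Q) (r : Q ⟶ P)
    (h : f ≫ r = 𝟙 P) : IsAdmissibleMono (pfExact R).exact f := by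
  have h' (x : P.obj) : r.hom.hom (f.hom.hom x) = x :=
    LinearMap.congr_fun (congrArg (fun t => t.hom.hom) h) x
  let K := LinearMap.ker r.hom.hom
  let g : Q.obj →ₗ[R] K := (LinearMap.id - f.hom.hom ∘ₗ r.hom.hom).codRestrict K fun x => by
    simp [K, h']
  have hg : g ∘ₗ K.subtype = LinearMap.id := by
    ext x
    have : r.hom.hom x.1 = 0 := x.2
    simp [g, this]
  have hsurj : Function.Surjective g := fun x => ⟨x.1, LinearMap.congr_fun hg x⟩
  let Z : Pf R := ⟨ModuleCat.of R K, Module.Finite.of_surjective g hsurj,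
    Module.Projective.of_split K.subtype g hg⟩
  let g' : Q ⟶ Z := ObjectProperty.homMk (ModuleCat.ofHom g)
  refine ⟨Z, g', ?_, ⟨⟨r, ObjectProperty.homMk (ModuleCat.ofHom K.subtype), h, ?_, ?_⟩⟩⟩
  · ext x
    change f.hom.hom x - f.hom.hom (r.hom.hom (f.hom.hom x)) = 0
    rw [h', sub_self]
  · ext x
    exact congrArg Subtype.val (LinearMap.congr_fun hg x)
  · ext x
    change f.hom.hom (r.hom.hom x) + (x - f.hom.hom (r.hom.hom x)) = x
    abel

namespace SplitSystem

/-- The inclusions between the submodules of a split system as an admissible Ind-diagram. -/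
def diagram (S : SplitSystem R M) : AdmissibleIndDiagram (pfExact R) where
  I := S.I
  X :=
    { obj := fun i => ⟨ModuleCat.of R (S.P i), S.finite i, S.projective i⟩
      map := fun f => ObjectProperty.homMk
        (ModuleCat.ofHom (Submodule.inclusion (S.P.monotone (leOfHom f))))
      map_id := fun _ => rfl
      map_comp := fun _ _ => rfl }
  admissible {i j} f := by
    obtain ⟨r, hr⟩ := S.split i j (leOfHom f)
    refine isAdmissibleMono_pf_of_retraction _ (ObjectProperty.homMk (ModuleCat.ofHom r)) ?_
    ext x
    exact congrArg Subtype.val (LinearMap.congr_fun hr x)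

/-- A module as a cocone on the submodules of a split system. -/
def cocone (S : SplitSystem R M) : Cocone (S.diagram.X ⋙ (isFGProjective R).ι) where
  pt := ModuleCat.of R M
  ι :=
    { app := fun i => ModuleCat.ofHom (S.P i).subtype
      naturality := fun _ _ _ => rfl }

theorem nonempty_isColimit_cocone (S : SplitSystem R M) : Nonempty (IsColimit S.cocone) :=
  nonempty_isColimit_of_directed (I := S.I) S.cocone
    (fun x => by
      obtain ⟨i, hi⟩ := S.exists_mem x
      exact ⟨i, ⟨x, hi⟩, rfl⟩)
    (fun i y hy => ⟨i, le_rfl, Subtype.ext hy⟩)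

end SplitSystem

end SplitSystem

/-! ### Small directed subsystems -/

section Size

open Classical in
/-- An upper bound of the values of `a` on `T` and of the bounds for all proper subsets of `T`. -/
noncomputable def directedBound {α I : Type*} [Preorder I] [IsDirected I (· ≤ ·)] [Nonempty I]
    (a : α → I) : Finset α → I :=
  Finset.strongInduction fun T ih => Classical.choose (Finset.exists_le
    (T.image a ∪ T.ssubsets.attach.image fun T' => ih T'.1 (Finset.mem_ssubsets.mp T'.2)))

-- Recursion over proper subsets makes the choice of upper bounds monotone, so a directed poset
-- receives an order-preserving map from the finite subsets of any family.
open Classical in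
theorem directedBound_spec {α I : Type*} [Preorder I] [IsDirected I (· ≤ ·)] [Nonempty I]
    (a : α → I) (T : Finset α) : (∀ x ∈ T, a x ≤ directedBound a T) ∧
      ∀ T' ⊂ T, directedBound a T' ≤ directedBound a T := by
  have key : ∀ i ∈ T.image a ∪ T.ssubsets.attach.image fun T' => directedBound a T'.1,
      i ≤ directedBound a T := by
    rw [directedBound, Finset.strongInduction_eq]
    exact Classical.choose_spec (Finset.exists_le _)
  refine ⟨fun x hx => key _ ?_, fun T' hT' => key _ ?_⟩
  · exact Finset.mem_union_left _ (Finset.mem_image_of_mem a hx)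
  · exact Finset.mem_union_right _ (Finset.mem_image.mpr
      ⟨⟨T', Finset.mem_ssubsets.mpr hT'⟩, Finset.mem_attach _ _, rfl⟩)

theorem directedBound_monotone {α I : Type*} [Preorder I] [IsDirected I (· ≤ ·)] [Nonempty I]
    (a : α → I) : Monotone (directedBound a) := by
  intro T T' h
  obtain rfl | h := eq_or_ssubset_of_subset h
  · exact le_rfl
  · exact (directedBound_spec a T').2 T h

theorem mk_finset_le_of_aleph0_le {α : Type u} {κ : Cardinal.{u}} (hκ : Cardinal.aleph0 ≤ κ)
    (h : Cardinal.mk α ≤ κ) : Cardinal.mk (Finset α) ≤ κ := by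
  cases finite_or_infinite α
  · exact (Cardinal.lt_aleph0_of_finite _).le.trans hκ
  · rwa [Cardinal.mk_finset_of_infinite]

variable {R : Type u} [Ring R]

/-- Pick an index for each generator and pull the system back along `directedBound`. The new union
is a submodule containing all generators, and a set of size at most an infinite `κ` has at most `κ`
finite subsets. -/
theorem SplitSystem.exists_mk_le {M : ModuleCat.{u} R} (S : SplitSystem R M) {κ : Cardinal.{u}}
    (hκ : Cardinal.aleph0 ≤ κ) (hM : isGeneratedBy R κ M) :
    ∃ S' : SplitSystem R M, Cardinal.mk S'.I ≤ κ := by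
  obtain ⟨s, hs, hspan⟩ := hM
  choose a ha using fun x : s => S.exists_mem x.1
  let Q : Finset s →o Submodule R M := S.P.comp ⟨directedBound a, directedBound_monotone a⟩
  refine ⟨⟨Finset s, Q, fun _ => S.finite _, fun _ => S.projective _,
    fun T T' h => S.split _ _ (directedBound_monotone a h), fun x => ?_⟩,
    mk_finset_le_of_aleph0_le hκ hs⟩
  rw [← Submodule.mem_iSup_of_directed _ Q.monotone.directed_le]
  have hQ (y : s) : y.1 ∈ Q {y} :=
    S.P.monotone ((directedBound_spec a {y}).1 y (Finset.mem_singleton_self y)) (ha y)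
  have : Submodule.span R s ≤ ⨆ T, Q T :=
    Submodule.span_le.mpr fun y hy => le_iSup Q {⟨y, hy⟩} (hQ ⟨y, hy⟩)
  exact this (hspan ▸ Submodule.mem_top)

theorem isGeneratedBy.of_surjective {M N : ModuleCat.{u} R} {κ : Cardinal.{u}}
    (hM : isGeneratedBy R κ M) (f : M →ₗ[R] N) (hf : Function.Surjective f) :
    isGeneratedBy R κ N := by
  obtain ⟨s, hs, hspan⟩ := hM
  refine ⟨f '' s, Cardinal.mk_image_le.trans hs, ?_⟩
  rw [Submodule.span_image, hspan, Submodule.map_top, LinearMap.range_eq_top.mpr hf]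

theorem isGeneratedBy.prod_finsupp {M : ModuleCat.{u} R} {κ : Cardinal.{u}}
    (hκ : Cardinal.aleph0 ≤ κ) (hM : isGeneratedBy R κ M) :
    isGeneratedBy R κ (ModuleCat.of R (M × (ℕ →₀ R))) := by
  obtain ⟨s, hs, hspan⟩ := hM
  refine ⟨LinearMap.inl R M (ℕ →₀ R) '' s ∪
    LinearMap.inr R M (ℕ →₀ R) '' Set.range fun n : ℕ => Finsupp.single n 1, ?_, ?_⟩
  · refine (Cardinal.mk_union_le _ _).trans (Cardinal.add_le_of_le hκ
      (Cardinal.mk_image_le.trans hs) (le_trans ?_ hκ))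
    exact Set.Countable.le_aleph0 ((Set.countable_range _).image _)
  · have : Submodule.span R (Set.range fun n : ℕ => (Finsupp.single n 1 : ℕ →₀ R)) = ⊤ := by
      simpa using (Finsupp.basisSingleOne (R := R) (ι := ℕ)).span_eq
    rw [Submodule.span_union, Submodule.span_image, Submodule.span_image, hspan, this,
      Submodule.map_top, Submodule.map_top]
    exact LinearMap.sup_range_inl_inr

theorem isGeneratedBy_of_isColimit {I : Type u} [PartialOrder I] [IsDirected I (· ≤ ·)]
    [Nonempty I] {D : I ⥤ Pf R} {c : Cocone (D ⋙ (isFGProjective R).ι)} (hc : IsColimit c)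
    {κ : Cardinal.{u}} (hκ : Cardinal.aleph0 ≤ κ) (hI : Cardinal.mk I ≤ κ) :
    isGeneratedBy R κ c.pt := by
  choose s hs using fun i => (inferInstance : Module.Finite R (D.obj i).obj).fg_top
  refine ⟨⋃ i, (c.ι.app i).hom '' (s i : Set (D.obj i).obj), ?_, ?_⟩
  · refine (Cardinal.mk_iUnion_le _).trans (Cardinal.mul_le_of_le hκ hI (ciSup_le' fun i => ?_))
    exact Cardinal.mk_image_le.trans ((Cardinal.lt_aleph0_of_finite _).le.trans hκ)
  · rw [eq_top_iff]
    intro x _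
    obtain ⟨i, y, rfl⟩ := exists_rep_of_isColimit hc x
    refine Submodule.span_mono (Set.subset_iUnion _ i) ?_
    rw [Submodule.span_image, hs i]
    exact ⟨y, Submodule.mem_top, rfl⟩

end Size

/-! ### The embedding of modules into left exact presheaves -/

section Presheaves

variable (R : Type u) [Ring R]

/-- The Yoneda embedding of `P_f(R)` is the restriction of `M ↦ Hom_R(-, M)`. -/
noncomputable def preadditiveYonedaPfIso :
    (preadditiveYoneda : Pf R ⥤ _) ≅ (isFGProjective R).ι ⋙ homPresheaf R :=
  NatIso.ofComponents (fun _ => NatIso.ofComponents (fun _ => AddEquiv.toAddCommGrpIso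
    { toFun := fun f => f.hom
      invFun := fun f => ObjectProperty.homMk f
      left_inv := fun _ => rfl
      right_inv := fun _ => rfl
      map_add' := fun _ _ => rfl }) (fun _ => rfl)) (fun _ => rfl)

variable {R}
variable {I : Type u} [PartialOrder I] [IsDirected I (· ≤ ·)] [Nonempty I]

/-- The image of `φ` is finitely generated, hence inside the image of one stage; projectivity of `P`
then lifts `φ` to that stage. -/
theorem exists_factor_of_isColimit {D : I ⥤ ModuleCat.{u} R} {c : Cocone D} (hc : IsColimit c)
    (P : Pf R) (φ : P.obj ⟶ c.pt) : ∃ (i : I) (ψ : P.obj ⟶ D.obj i), ψ ≫ c.ι.app i = φ := by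
  let F : I →o Submodule R c.pt := ⟨fun i => LinearMap.range (c.ι.app i).hom, fun i j h => by
    change LinearMap.range (c.ι.app i).hom ≤ LinearMap.range (c.ι.app j).hom
    rw [← c.w (homOfLE h), ModuleCat.hom_comp]
    exact LinearMap.range_comp_le_range _ _⟩
  obtain ⟨i, hi⟩ := exists_le_of_fg_of_directed F (fun x => exists_rep_of_isColimit hc x)
    (X := LinearMap.range φ.hom) (Module.Finite.iff_fg.mp inferInstance)
  obtain ⟨ψ, hψ⟩ := Module.projective_lifting_property (c.ι.app i).hom.rangeRestrict
    (φ.hom.codRestrict _ fun x => hi ⟨x, rfl⟩) (LinearMap.surjective_rangeRestrict _)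
  refine ⟨i, ModuleCat.ofHom ψ, ?_⟩
  ext x
  exact congrArg Subtype.val (LinearMap.congr_fun hψ x)

theorem exists_comp_map_eq_zero_of_isColimit {D : I ⥤ ModuleCat.{u} R} {c : Cocone D}
    (hc : IsColimit c) (P : Pf R) {i : I} (φ : P.obj ⟶ D.obj i) (h : φ ≫ c.ι.app i = 0) :
    ∃ (j : I) (hij : i ≤ j), φ ≫ D.map (homOfLE hij) = 0 := by
  have : IsDirected (Set.Ici i) (· ≤ ·) := ⟨fun a b => by
    obtain ⟨k, hak, hbk⟩ := exists_ge_ge a.1 b.1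
    exact ⟨⟨k, a.2.trans hak⟩, hak, hbk⟩⟩
  -- The kernels at stages above `i` form a directed family exhausting the finitely generated `P`,
  -- so one of them is everything.
  let F : Set.Ici i →o Submodule R P.obj :=
    ⟨fun j => LinearMap.ker (φ ≫ D.map (homOfLE j.2)).hom, fun j k hjk x hx => by
      change (φ ≫ D.map (homOfLE k.2)).hom x = 0
      rw [← homOfLE_comp j.2 hjk, D.map_comp, ← Category.assoc]
      exact (congrArg (D.map (homOfLE hjk)).hom hx).trans (map_zero _)⟩
  obtain ⟨j, hj⟩ := exists_le_of_fg_of_directed F (fun x => by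
    obtain ⟨j, hij, hj⟩ := exists_map_eq_zero_of_isColimit hc (φ.hom x)
      (LinearMap.congr_fun (congrArg ModuleCat.Hom.hom h) x)
    exact ⟨⟨j, hij⟩, hj⟩) (X := ⊤) Module.Finite.fg_top
  refine ⟨j.1, j.2, ?_⟩
  ext x
  exact hj (Submodule.mem_top : x ∈ ⊤)

/-- A cocone of abelian groups over a directed poset is a colimit cocone if it is jointly
surjective and elements with the same image become equal at a later stage. -/
theorem nonempty_isColimit_of_directed_addCommGrp {K : I ⥤ AddCommGrpCat.{u}} (c : Cocone K)
    (hsurj : ∀ x : c.pt, ∃ (i : I) (y : K.obj i), c.ι.app i y = x)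
    (hinj : ∀ (i : I) (y z : K.obj i), c.ι.app i y = c.ι.app i z →
      ∃ (j : I) (hij : i ≤ j), K.map (homOfLE hij) y = K.map (homOfLE hij) z) :
    Nonempty (IsColimit c) := by
  have : ReflectsColimitsOfShape I (forget AddCommGrpCat.{u}) :=
    reflectsColimitsOfShape_of_reflectsIsomorphisms
  refine ⟨isColimitOfReflects (forget AddCommGrpCat.{u}) ?_⟩
  refine Types.FilteredColimit.isColimitOf' _ _ (fun x => ?_) (fun i y z h => ?_)
  · obtain ⟨i, y, rfl⟩ := hsurj x
    exact ⟨i, y, rfl⟩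
  · obtain ⟨j, hij, hj⟩ := hinj i y z h
    exact ⟨j, homOfLE hij, hj⟩

/-- The functor `M ↦ Hom_R(-, M)` preserves directed colimits. -/
theorem nonempty_isColimit_homPresheaf_mapCocone {D : I ⥤ ModuleCat.{u} R} {c : Cocone D}
    (hc : IsColimit c) : Nonempty (IsColimit ((homPresheaf R).mapCocone c)) := by
  refine ⟨evaluationJointlyReflectsColimits _ fun P => Classical.choice ?_⟩
  refine nonempty_isColimit_of_directed_addCommGrp (I := I) _ (fun φ => ?_) (fun i φ ψ h => ?_)
  · exact exists_factor_of_isColimit hc P.unop φ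
  · let φ' : P.unop.obj ⟶ D.obj i := φ
    let ψ' : P.unop.obj ⟶ D.obj i := ψ
    have h' : φ' ≫ c.ι.app i = ψ' ≫ c.ι.app i := h
    obtain ⟨j, hij, hj⟩ := exists_comp_map_eq_zero_of_isColimit hc P.unop (φ' - ψ')
      (by rw [Preadditive.sub_comp, h', sub_self])
    rw [Preadditive.sub_comp] at hj
    exact ⟨j, hij, sub_eq_zero.mp hj⟩

theorem AdmissibleIndDiagram.nonempty_homPresheaf_iso (D : AdmissibleIndDiagram (pfExact R))
    {c : Cocone (D.X ⋙ (isFGProjective R).ι)} (hc : IsColimit c) :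
    Nonempty ((homPresheaf R).obj c.pt ≅ D.presheaf) := by
  obtain ⟨h⟩ := nonempty_isColimit_homPresheaf_mapCocone hc
  exact ⟨h.coconePointsIsoOfNatIso (colimit.isColimit (D.X ⋙ preadditiveYoneda))
    (Functor.isoWhiskerLeft D.X (preadditiveYonedaPfIso R)).symm⟩

/-- Admissible monics split, so every restriction map of duals is surjective and stabilization holds
already at `j = i`. -/
theorem AdmissibleIndDiagram.isFlatMittagLeffler_colimit
    (D : AdmissibleIndDiagram (pfExact R)) :
    isFlatMittagLeffler R (colimit (D.X ⋙ (isFGProjective R).ι)) := by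
  have h {i j : D.I} (f : i ⟶ j) : dualImage (D.X.map f).hom = Set.univ := by
    obtain ⟨Z, g, hg, ⟨σ⟩⟩ := D.admissible f
    refine Set.eq_univ_of_forall fun φ => ⟨φ ∘ₗ σ.r.hom.hom, ?_⟩
    have := congrArg (fun t => t.hom.hom) σ.f_r
    change φ ∘ₗ (D.X.map f ≫ σ.r).hom.hom = φ
    exact congrArg (φ.comp ·) this
  exact ⟨D.I, inferInstance, inferInstance, inferInstance, D.X,
    fun i => ⟨i, le_rfl, fun k hk => by rw [h, h]⟩, ⟨Iso.refl _⟩⟩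

variable (R)

/-- The module `R` as an object of `P_f(R)`. -/
def pfSelf : Pf R :=
  ⟨ModuleCat.of R R, inferInstanceAs (Module.Finite R R), inferInstanceAs (Module.Projective R R)⟩

variable {R}

/-- The map `R → M` with value `x` at `1`. -/
def pfSelfHom {M : ModuleCat.{u} R} (x : M) : (pfSelf R).obj ⟶ M :=
  ModuleCat.ofHom (LinearMap.toSpanSingleton R M x)

theorem pfSelfHom_apply_one {M : ModuleCat.{u} R} (x : M) : (pfSelfHom x).hom (1 : R) = x :=
  one_smul R x

theorem pfSelfHom_comp {M N : ModuleCat.{u} R} (x : M) (f : M ⟶ N) :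
    pfSelfHom x ≫ f = pfSelfHom (f.hom x) := by
  refine ModuleCat.hom_ext (LinearMap.ext fun r => ?_)
  exact f.hom.map_smul r x

theorem pfSelfHom_add {M : ModuleCat.{u} R} (x y : M) :
    pfSelfHom (x + y) = pfSelfHom x + pfSelfHom y :=
  ModuleCat.hom_ext (LinearMap.ext fun r => smul_add (M := R) (A := M) r x y)

variable (R)

instance modToLex_faithful : (modToLex R).Faithful where
  map_injective {M N} f g h := by
    ext x
    have h1 : pfSelfHom x ≫ f = pfSelfHom x ≫ g :=
      LinearMap.congr_fun (M := (pfSelf R).obj ⟶ M) (congrArg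
        (fun t => (AddCommGrpCat.Hom.hom (t.hom.app (op (pfSelf R)))).toIntLinearMap) h)
        (pfSelfHom x)
    rw [pfSelfHom_comp, pfSelfHom_comp] at h1
    rw [← pfSelfHom_apply_one (f.hom x), h1, pfSelfHom_apply_one]

/-- Evaluation at `R` recovers the underlying module. Naturality along right multiplications `R → R`
gives linearity, and naturality along maps `R → Q` determines `η` on all of `P_f(R)`. -/
instance modToLex_full : (modToLex R).Full where
  map_surjective {M N} η := by
    let η' (Q : Pf R) : (Q.obj ⟶ M) →+ (Q.obj ⟶ N) := (η.hom.app (op Q)).hom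
    have hη' {Q Q' : Pf R} (a : Q.obj ⟶ Q'.obj) (b : Q'.obj ⟶ M) : η' Q (a ≫ b) = a ≫ η' Q' b :=
      ConcreteCategory.congr_hom (η.hom.naturality (ObjectProperty.homMk a : Q ⟶ Q').op) b
    let f : M →ₗ[R] N :=
      { toFun := fun x => (η' (pfSelf R) (pfSelfHom x)).hom (1 : R)
        map_add' := fun x y => by
          rw [pfSelfHom_add, map_add]
          rfl
        map_smul' := fun r x => by
          have h1 : (pfSelfHom (M := (pfSelf R).obj) r) ≫ pfSelfHom x = pfSelfHom (r • x) :=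
            pfSelfHom_comp _ _
          have h2 := (η' (pfSelf R) (pfSelfHom x)).hom.map_smul r (1 : R)
          rw [← h1, hη']
          refine Eq.trans ?_ h2
          exact congrArg (η' (pfSelf R) (pfSelfHom x)).hom ((one_mul r).trans (mul_one r).symm) }
    have key (Q : Pf R) (b : Q.obj ⟶ M) : b ≫ ModuleCat.ofHom f = η' Q b := by
      ext x
      change (η' (pfSelf R) (pfSelfHom (b.hom x))).hom (1 : R) = _
      rw [← pfSelfHom_comp, hη', pfSelfHom_comp, pfSelfHom_apply_one]
    refine ⟨ModuleCat.ofHom f, ObjectProperty.hom_ext _ ?_⟩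
    ext Q b
    exact key Q.unop b

end Presheaves

/-! ### Assembling the equivalences -/

section Main

variable {R : Type u} [Ring R]

theorem exists_splitSystem {M : ModuleCat.{u} R} (hM : isFlatMittagLeffler R M) :
    Nonempty (SplitSystem R (M × (ℕ →₀ R))) :=
  isDirectedUnionOfSplitFGProjectives_iff.mp hM.hasUniversalFactorizations.isDirectedUnion

/-- `N` is also a retract of `M ⊕ R^(ω)`, which is a union of a split system. -/
theorem isFlatMittagLeffler.of_retract {M N : ModuleCat.{u} R} (r : Retract N M)
    (hM : isFlatMittagLeffler R M) : isFlatMittagLeffler R N := by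
  obtain ⟨S⟩ := exists_splitSystem hM
  refine S.isFlatMittagLeffler_of_retract N (LinearMap.inl R M (ℕ →₀ R) ∘ₗ r.i.hom)
    (r.r.hom ∘ₗ LinearMap.fst R M (ℕ →₀ R)) ?_
  ext x
  exact LinearMap.congr_fun (congrArg ModuleCat.Hom.hom r.retract) x

theorem SplitSystem.nonempty_iso_presheaf {M : Type u} [AddCommGroup M] [Module R M]
    (S : SplitSystem R M) :
    Nonempty (((modToLex R).obj (ModuleCat.of R M)).obj ≅ S.diagram.presheaf) := by
  obtain ⟨hc⟩ := S.nonempty_isColimit_cocone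
  exact S.diagram.nonempty_homPresheaf_iso hc

theorem isFlatMittagLeffler.prod_finsupp {M : ModuleCat.{u} R} (hM : isFlatMittagLeffler R M) :
    isFlatMittagLeffler R (ModuleCat.of R (M × (ℕ →₀ R))) := by
  obtain ⟨S⟩ := exists_splitSystem hM
  exact S.isFlatMittagLeffler_of_retract (ModuleCat.of R (M × (ℕ →₀ R))) LinearMap.id
    LinearMap.id rfl

variable (R) in
/-- `M` as a retract of `M ⊕ R ^ (ω)`. -/
noncomputable def retractProdFinsupp (M : ModuleCat.{u} R) : Retract M (ModuleCat.of R (M × (ℕ →₀ R))) where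
  i := ModuleCat.ofHom (LinearMap.inl R M (ℕ →₀ R))
  r := ModuleCat.ofHom (LinearMap.fst R M (ℕ →₀ R))

theorem AdmissibleIndDiagram.nonempty_modToLex_iso (D : AdmissibleIndDiagram (pfExact R))
    {Y : Lex (pfExact R)} (e : Y.obj ≅ D.presheaf) :
    Nonempty ((modToLex R).obj (colimit (D.X ⋙ (isFGProjective R).ι)) ≅ Y) := by
  obtain ⟨i⟩ := D.nonempty_homPresheaf_iso (colimit.isColimit _)
  exact ⟨(isLeftExact (pfExact R)).isoMk (i ≪≫ e.symm)⟩

end Main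

end AdmissibleInd

theorem propositionB3 (R : Type u) [Ring R] :
    (∀ M : ModuleCat.{u} R, isFlatMittagLeffler R M →
      isFlatMittagLeffler R (ModuleCat.of R (M × (ℕ →₀ R))) ∧
      isAdmissibleInd (pfExact R) ((modToLex R).obj (ModuleCat.of R (M × (ℕ →₀ R)))) ∧
      IsDirectedUnionOfSplitFGProjectives R (M × (ℕ →₀ R))) ∧
    (∃ e : FM (pfExact R) ≌ FMMod R,
      Nonempty (Idempotents.toKaroubi (IndA (pfExact R)) ⋙ e.functor ⋙
          (isFlatMittagLeffler R).ι ⋙ modToLex R ≅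
        (isAdmissibleInd (pfExact R)).ι)) ∧
    (∀ κ : Cardinal.{u}, Cardinal.aleph0 ≤ κ →
      ∃ e : FMOfSize (pfExact R) κ ≌ FMModOfSize R κ,
        Nonempty (Idempotents.toKaroubi (IndAOfSize (pfExact R) κ) ⋙ e.functor ⋙
            (isFlatMittagLeffler R ⊓ isGeneratedBy R κ).ι ⋙ modToLex R ≅
          (isAdmissibleIndOfSize (pfExact R) κ).ι)) := by
  have h1 (M : ModuleCat.{u} R) (hM : isFlatMittagLeffler R M) :
      isAdmissibleInd (pfExact R) ((modToLex R).obj (ModuleCat.of R (M × (ℕ →₀ R)))) := by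
    obtain ⟨S⟩ := exists_splitSystem hM
    exact ⟨S.diagram, S.nonempty_iso_presheaf⟩
  refine ⟨fun M hM => ⟨hM.prod_finsupp, h1 M hM,
    hM.hasUniversalFactorizations.isDirectedUnion⟩, ?_, fun κ hκ => ?_⟩
  · refine exists_karoubi_equivalence (modToLex R) _ _ (fun X Y r hY => hY.of_retract r) ?_
      (fun M hM => ⟨_, hM.prod_finsupp, h1 M hM, ⟨retractProdFinsupp R M⟩⟩)
    rintro Y ⟨D, ⟨e⟩⟩
    exact ⟨_, D.isFlatMittagLeffler_colimit, D.nonempty_modToLex_iso e⟩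
  · refine exists_karoubi_equivalence (modToLex R) _ _
      (fun X Y r hY => ⟨hY.1.of_retract r, hY.2.of_surjective r.r.hom fun x =>
        ⟨r.i.hom x, LinearMap.congr_fun (congrArg ModuleCat.Hom.hom r.retract) x⟩⟩) ?_
      (fun M hM => ⟨_, ⟨hM.1.prod_finsupp, hM.2.prod_finsupp hκ⟩, ?_, ⟨retractProdFinsupp R M⟩⟩)
    · rintro Y ⟨D, hD, ⟨e⟩⟩
      exact ⟨_, ⟨D.isFlatMittagLeffler_colimit,
        isGeneratedBy_of_isColimit (Limits.colimit.isColimit _) hκ hD⟩, D.nonempty_modToLex_iso e⟩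
    · obtain ⟨S⟩ := exists_splitSystem hM.1
      -- The system of all locally split submodules may have more than `κ` members. Since `κ` is
      -- infinite, `M ⊕ R^(ω)` is still `κ`-generated and the system can be shrunk.
      obtain ⟨S', hS'⟩ := SplitSystem.exists_mk_le (M := ModuleCat.of R _) S hκ
        (hM.2.prod_finsupp hκ)
      exact ⟨S'.diagram, hS', S'.nonempty_iso_presheaf⟩
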